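/- Let $E,F$ be real normed spaces, let $X=(X_1,\dots,X_n)$ and $X'=(X'_1,\dots,X'_n)$ be point clouds in $E$, let $\tilde X=(\tilde X_1,\dots,\tilde X_n)$ and $\tilde X'=(\tilde X'_1,\dots,\tilde X'_n)$ be point clouds in $F$ (all of the same size $n$), and let $k\ge 0$. Definitions. For the pair $(X,\tilde X)$ put $w_{ij}=\|X_i-X_j\|$ and $\tilde w_{ij}=\|\tilde X_i-\tilde X_j\|$. Let $\hat{\mathcal G}^{w,\tilde w}$ be the weighted graph on $2n$ vertices with the matrix of edge weights $$m=\begin{pmatrix}0&(w_+)^{\mathsf T}\\ w_+&\min(w,\tilde w)\end{pmatrix},$$ where $w_+$ is $w$ with the entries strictly below the diagonal replaced by $+\infty$ and $\min$ is taken entrywise. For $\alpha\in\mathbb R$ let $\mathrm{VR}_\alpha$ be the simplicial complex of the nonempty vertex sets $\sigma$ with $m_{ab}\le\alpha$ for all $a,b\in\sigma$. The barcode $\text{R-Cross-Barcode}_k(X,\tilde X)$ is the $k$-th persistence barcode of the filtration $(\mathrm{VR}_\alpha)_{\alpha\in\mathbb R}$: the finite multiset of intervals $[b,d)$ with $b\in\mathbb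 R$, $b<d\le+\infty$, that appear in the decomposition of the persistence module $\alpha\mapsto \tilde H_k(\mathrm{VR}_\alpha;\mathbb Z/2)$ (reduced homology, which differs from ordinary homology only for $k=0$) into interval modules. The bottleneck distance $d_B(B,B')$ is the infimum of the $\varepsilon\ge0$ for which there is a partial matching between $B$ and $B'$ such that matched intervals $[b,d)$, $[b',d')$ satisfy $|b-b'|\le\varepsilon$ and $|d-d'|\le\varepsilon$ (with $|\infty-\infty|=0$) and every unmatched interval $[b,d)$ has $(d-b)/2\le\varepsilon$. Statement. The barcodes $\text{R-Cross-Barcode}_k(X,\tilde X)$ and $\text{R-Cross-Barcode}_k(X',\tilde X')$ exist and are unique, and $$d_B\bigl(\text{R-Cross-Barcode}_k(X,\tilde X),\ \text{R-Cross-Barcode}_k(X',\tilde X')\bigr)\ \le\ 2\max\Bigl(\max_i\|X'_i-X_i\|,\ \max_j\|\tilde X'_j-\tilde X_j\|\Bigr).$$ -/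

import Mathlib

open scoped ENNReal

noncomputable section

namespace RTD

/-! ### Simplicial homology modulo 2 -/

section Homology

variable {V : Type*}

/-- The space `C_k` of `k`-chains of a simplicial complex: combinations of its simplices with
`k + 1` vertices. -/
def chains (K : PreAbstractSimplicialComplex V) (k : ℕ) : Submodule (ZMod 2) (Finset V → ZMod 2) where
  carrier := {x | ∀ σ, x σ ≠ 0 → σ ∈ K.faces ∧ σ.card = k + 1}
  zero_mem' := fun _ h => absurd rfl h
  add_mem' := fun {x y} hx hy σ h => by
    by_cases h0 : x σ = 0
    · exact hy σ fun h1 => h (by simp [h0, h1])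
    · exact hx σ h0
  smul_mem' := fun c x hx σ h => hx σ fun h0 => h (by simp [h0])

theorem chains_mono {K L : PreAbstractSimplicialComplex V} (h : K ≤ L) (k : ℕ) :
    chains K k ≤ chains L k :=
  fun _ hx σ hσ => ⟨h (hx σ hσ).1, (hx σ hσ).2⟩

variable [Fintype V] [DecidableEq V]

/-- The boundary operator modulo 2 on formal combinations of sets of vertices: every simplex is
sent to the sum of its facets. The empty simplex, of dimension `-1`, is the facet of every vertex,
so that the chain complex is the augmented one and its homology is reduced homology. -/
def boundary : (Finset V → ZMod 2) →ₗ[ZMod 2] (Finset V → ZMod 2) :=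
  Fintype.linearCombination (ZMod 2) fun σ : Finset V => ∑ v ∈ σ, Pi.single (σ.erase v) 1

/-- The `k`-cycles `ker ∂_k`. -/
def cycles (K : PreAbstractSimplicialComplex V) (k : ℕ) : Submodule (ZMod 2) (Finset V → ZMod 2) :=
  chains K k ⊓ LinearMap.ker boundary

/-- The `k`-boundaries `im ∂_{k+1}`. -/
def boundaries (K : PreAbstractSimplicialComplex V) (k : ℕ) :
    Submodule (ZMod 2) (Finset V → ZMod 2) :=
  (chains K (k + 1)).map boundary

theorem boundary_single (σ : Finset V) :
    boundary (Pi.single σ 1) = ∑ v ∈ σ, (Pi.single (σ.erase v) 1 : Finset V → ZMod 2) := by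
  simp [boundary]

theorem boundary_boundary (x : Finset V → ZMod 2) : boundary (boundary x) = 0 := by
  have key : (boundary (V := V)).comp boundary = 0 := by
    refine LinearMap.pi_ext' fun σ => LinearMap.ext_ring ?_
    simp only [LinearMap.comp_apply, LinearMap.coe_single, boundary_single, map_sum,
      LinearMap.zero_apply]
    rw [Finset.sum_sigma']
    refine Finset.sum_involution (fun p _ => ⟨p.2, p.1⟩) ?_ ?_ ?_ ?_
    · rintro ⟨a, b⟩ _
      rw [Finset.erase_right_comm]
      ext τ
      exact CharTwo.add_self_eq_zero _
    · rintro ⟨a, b⟩ hp _ heq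
      simp only [Finset.mem_sigma, Finset.mem_erase] at hp
      exact hp.2.1 (by simpa using congrArg Sigma.fst heq)
    · rintro ⟨a, b⟩ hp
      simp only [Finset.mem_sigma, Finset.mem_erase] at hp ⊢
      exact ⟨hp.2.2, fun h => hp.2.1 h.symm, hp.1⟩
    · rintro ⟨a, b⟩ _
      rfl
  exact LinearMap.congr_fun key x

theorem boundaries_le_cycles (K : PreAbstractSimplicialComplex V) (k : ℕ) :
    boundaries K k ≤ cycles K k := by
  rintro _ ⟨x, hx, rfl⟩
  refine ⟨?_, boundary_boundary x⟩
  rw [boundary, Fintype.linearCombination_apply]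
  refine Submodule.sum_mem _ fun σ _ => ?_
  by_cases hσ : x σ = 0
  · rw [hσ, zero_smul]
    exact Submodule.zero_mem _
  refine Submodule.smul_mem _ _ (Submodule.sum_mem _ fun v hv τ hτ => ?_)
  obtain ⟨hK, hc⟩ := hx σ hσ
  have hcard : (σ.erase v).card = k + 1 := by rw [Finset.card_erase_of_mem hv, hc]; rfl
  have hτ' : τ = σ.erase v := by
    by_contra hne
    exact hτ (Pi.single_eq_of_ne hne _)
  rw [hτ']
  exact ⟨(K.isRelLowerSet_faces hK).2 (Finset.erase_subset v σ)
    (Finset.card_pos.mp (by omega)), hcard⟩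

theorem cycles_mono {K L : PreAbstractSimplicialComplex V} (h : K ≤ L) (k : ℕ) :
    cycles K k ≤ cycles L k :=
  inf_le_inf_right _ (chains_mono h k)

/-- The `k`-th (reduced) homology group `ker ∂_k / im ∂_{k+1}` modulo 2. -/
abbrev Homology (K : PreAbstractSimplicialComplex V) (k : ℕ) : Type _ :=
  cycles K k ⧸ (boundaries K k).submoduleOf (cycles K k)

/-- The linear map induced in homology by the inclusion of a subcomplex. -/
def homologyMap {K L : PreAbstractSimplicialComplex V} (h : K ≤ L) (k : ℕ) :
    Homology K k →ₗ[ZMod 2] Homology L k :=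
  Submodule.mapQ _ _ (Submodule.inclusion (cycles_mono h k))
    fun _ hx => Submodule.map_mono (chains_mono h (k + 1)) hx

end Homology

/-! ### Vietoris-Rips filtration and persistence barcodes of weighted graphs -/

section Barcode

variable {V : Type*}

/-- The Vietoris-Rips complex at threshold `α` of the weighted graph on `V` with matrix of edge
weights `m` (the weight `⊤` means that the edge never appears). -/
def vietorisRips (m : Matrix V V EReal) (α : ℝ) : PreAbstractSimplicialComplex V where
  faces := {σ | σ.Nonempty ∧ ∀ i ∈ σ, ∀ j ∈ σ, m i j ≤ α}
  isRelLowerSet_faces := fun _ hσ =>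
    ⟨hσ.1, fun _ hτ hne => ⟨hne, fun i hi j hj => hσ.2 i (hτ hi) j (hτ hj)⟩⟩

theorem vietorisRips_mono (m : Matrix V V EReal) {α β : ℝ} (h : α ≤ β) :
    vietorisRips m α ≤ vietorisRips m β :=
  fun _ hσ => ⟨hσ.1, fun i hi j hj => (hσ.2 i hi j hj).trans (EReal.coe_le_coe_iff.mpr h)⟩

/-- A bar of a persistence barcode: a nonempty interval `[birth, death)`, where `death = ⊤` is
allowed. -/
structure Bar where
  birth : ℝ
  death : EReal
  birth_lt_death : (birth : EReal) < death

/-- The finite multiset of bars `B` is the `k`-th persistence barcode of the weighted graph with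
weights `m`: there are basic homology classes `c i`, one for each bar, with `c i` born at the
threshold `birth` in the `k`-th homology of the Vietoris-Rips complex, such that the image of `c i`
vanishes from the threshold `death` on, and such that at every threshold `α` the images of those
`c i` with `birth ≤ α < death` form a basis of the homology. Equivalently, the `c i` are the
generators of the summands in a decomposition of the persistence module
`α ↦ H_k (VR_α)` into a direct sum of interval modules. -/
def IsBarcode [Fintype V] [DecidableEq V] (m : Matrix V V EReal) (k : ℕ) (B : Multiset Bar) : Prop :=
  ∃ (N : ℕ) (bar : Fin N → Bar) (c : ∀ i, Homology (vietorisRips m (bar i).birth) k),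
    B = Finset.univ.val.map bar ∧
    (∀ (i : Fin N) (α : ℝ) (h : (bar i).birth ≤ α), (bar i).death ≤ α →
      homologyMap (vietorisRips_mono m h) k (c i) = 0) ∧
    ∀ α : ℝ,
      let e : {i : Fin N // (bar i).birth ≤ α ∧ (α : EReal) < (bar i).death} →
          Homology (vietorisRips m α) k :=
        fun i => homologyMap (vietorisRips_mono m i.2.1) k (c i.1)
      LinearIndependent (ZMod 2) e ∧ Submodule.span (ZMod 2) (Set.range e) = ⊤

end Barcode

/-! ### Bottleneck distance -/

/-- The distance of two deaths; `⊤` is at distance `0` from itself and at distance `∞` from every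
real number. -/
def deathDist (d d' : EReal) : ℝ≥0∞ :=
  if d = d' then 0 else (d - d').abs

/-- The `ℓ^∞` distance of two bars seen as points of the extended plane. -/
def barDist (b b' : Bar) : ℝ≥0∞ :=
  max (edist b.birth b'.birth) (deathDist b.death b'.death)

/-- The `ℓ^∞` distance of a bar to the diagonal: half of its length. -/
def diagDist (b : Bar) : ℝ≥0∞ :=
  (b.death - b.birth).abs / 2

/-- The bottleneck distance of two finite barcodes: the infimum of the `ε` for which there is a
partial matching, given by the multiset `M` of matched pairs and the multisets `U`, `U'` of
unmatched bars, such that matched bars are within `ε` of each other and unmatched bars are within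
`ε` of the diagonal. -/
def bottleneckDist (B B' : Multiset Bar) : ℝ≥0∞ :=
  sInf {ε | ∃ (M : Multiset (Bar × Bar)) (U U' : Multiset Bar),
    M.map Prod.fst + U = B ∧ M.map Prod.snd + U' = B' ∧
    (∀ p ∈ M, barDist p.1 p.2 ≤ ε) ∧ (∀ b ∈ U, diagDist b ≤ ε) ∧ ∀ b ∈ U', diagDist b ≤ ε}

/-! ### The R-Cross-Barcode -/

/-- The matrix `w₊`: the part of `w` strictly below the diagonal is replaced by `+∞`. -/
def wPlus {n : ℕ} (w : Matrix (Fin n) (Fin n) ℝ) : Matrix (Fin n) (Fin n) EReal :=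
  Matrix.of fun i j => if j < i then ⊤ else (w i j : EReal)

/-- The edge weights of the graph `Ĝ^{w, w'}` with doubled set of vertices: the block matrix
with rows `(0, (w₊)ᵀ)` and `(w₊, min (w, w'))`. -/
def doubledWeights {n : ℕ} (w w' : Matrix (Fin n) (Fin n) ℝ) :
    Matrix (Fin n ⊕ Fin n) (Fin n ⊕ Fin n) EReal :=
  Matrix.fromBlocks 0 (wPlus w).transpose (wPlus w)
    (Matrix.of fun i j => ((min (w i j) (w' i j) : ℝ) : EReal))

/-- The matrix of pairwise distances of a point cloud. -/
def distMatrix {E : Type*} [NormedAddCommGroup E] {n : ℕ} (X : Fin n → E) :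
    Matrix (Fin n) (Fin n) ℝ :=
  Matrix.of fun i j => ‖X i - X j‖

/-- `B` is the `R-Cross-Barcode_k (X, Y)` of two point clouds of the same size. -/
def IsRCrossBarcode {E F : Type*} [NormedAddCommGroup E] [NormedAddCommGroup F] {n : ℕ} (k : ℕ)
    (X : Fin n → E) (Y : Fin n → F) (B : Multiset Bar) : Prop :=
  IsBarcode (doubledWeights (distMatrix X) (distMatrix Y)) k B

end RTD

end

/-! Moving every point by at most `δ` changes distances by at most `2δ`, hence each weight of the
doubled graph by at most `ε = 2δ`, and each Vietoris-Rips complex lies in the other one at a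
threshold larger by `ε`. Cycles and boundaries at all thresholds are subspaces `Z a`, `B a` of one
finite-dimensional space, so interleavings are plain inclusions and no abstract persistence modules
are needed.

Existence: a basis adapted to both filtrations `Z` and `B` (`exists_adapted_basis`) splits the
module, each vector living from its entry into `Z` to its entry into `B`.

Stability: writing the generators of each module in those of the other gives matrices `F`, `G` whose
product is the identity on the entries that matter for long bars. With bars ordered by midpoint,
this yields Hall's condition (`PersistenceBasis.card_le`). Matchings of the long bars on both sides
are merged by Schröder-Bernstein. Uniqueness is the case `ε = 0`. -/

noncomputable section

namespace RTD

/-! ### Bases adapted to two filtrations -/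

section AdaptedBasis

variable {K W : Type*} [Field K] [AddCommGroup W] [Module K W]

/-- Two filtrations of a finite-dimensional space have a common adapted basis. -/
theorem exists_adapted_basis [FiniteDimensional K W] {P Q : ℝ → Submodule K W}
    (hP : Monotone P) (hQ : Monotone Q) (U : Submodule K W) :
    ∃ s : Set W, LinearIndepOn K id s ∧ Submodule.span K s = U ∧
      (∀ a, U ⊓ P a ≤ Submodule.span K (s ∩ P a)) ∧
      ∀ a, U ⊓ Q a ≤ Submodule.span K (s ∩ Q a) := by
  induction U using WellFoundedLT.induction with
  | ind U ih =>
  by_cases hU : U = ⊥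
  · subst hU
    exact ⟨∅, linearIndepOn_empty K id, Submodule.span_empty, by simp, by simp⟩
  -- `D` is the largest proper trace of `P` on `U`. A hyperplane `H` of `U` above it contains every
  -- proper trace, so `P` puts no constraint on the vector that completes a basis of `H`.
  obtain ⟨D, hDU, hD⟩ : ∃ D < U, ∀ a, U ⊓ P a < U → U ⊓ P a ≤ D := by
    by_cases hne : ∃ a, U ⊓ P a < U
    · obtain ⟨D, ⟨⟨a, rfl⟩, hDU⟩, hmax⟩ := WellFounded.has_min
        (wellFounded_gt : WellFounded ((· > ·) : Submodule K W → Submodule K W → Prop))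
        {D | (∃ a, U ⊓ P a = D) ∧ D < U} (by obtain ⟨a, ha⟩ := hne; exact ⟨_, ⟨a, rfl⟩, ha⟩)
      refine ⟨_, hDU, fun b hb => ?_⟩
      rcases le_total a b with h | h
      · exact le_of_eq (((inf_le_inf_left U (hP h)).eq_of_not_lt
          (hmax _ ⟨⟨b, rfl⟩, hb⟩)).symm)
      · exact inf_le_inf_left U (hP h)
    · exact ⟨⊥, bot_lt_iff_ne_bot.mpr hU, fun a ha => absurd ⟨a, ha⟩ hne⟩
  obtain ⟨H, hDH, hHU⟩ := exists_le_covBy_of_lt hDU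
  -- The completing vector comes from the smallest trace of `Q` not contained in `H`, hence lies in
  -- all such traces.
  obtain ⟨w, hwU, hwH, hwQ⟩ : ∃ w ∈ U, w ∉ H ∧ ∀ a, ¬ U ⊓ Q a ≤ H → w ∈ Q a := by
    by_cases hne : ∃ a, ¬ U ⊓ Q a ≤ H
    · obtain ⟨D, ⟨⟨a, rfl⟩, hDU⟩, hmin⟩ := WellFounded.has_min
        (wellFounded_lt : WellFounded ((· < ·) : Submodule K W → Submodule K W → Prop))
        {D | (∃ a, U ⊓ Q a = D) ∧ ¬ D ≤ H} (by obtain ⟨a, ha⟩ := hne; exact ⟨_, ⟨a, rfl⟩, ha⟩)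
      obtain ⟨w, hw, hwH⟩ := SetLike.not_le_iff_exists.mp hDU
      refine ⟨w, hw.1, hwH, fun b hb => ?_⟩
      rcases le_total a b with h | h
      · exact hQ h hw.2
      · rw [← (inf_le_inf_left U (hQ h)).eq_of_not_lt (hmin _ ⟨⟨b, rfl⟩, hb⟩)] at hw
        exact hw.2
    · obtain ⟨w, hw, hwH⟩ := SetLike.not_le_iff_exists.mp hHU.lt.not_ge
      exact ⟨w, hw, hwH, fun a ha => absurd ⟨a, ha⟩ hne⟩
  obtain ⟨s, hs, hsH, hsP, hsQ⟩ := ih H hHU.lt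
  have hsup : Submodule.span K {w} ⊔ H = U := by
    rcases hHU.eq_or_eq le_sup_right
      (sup_le ((Submodule.span_singleton_le_iff_mem _ _).mpr hwU) hHU.le) with h | h
    · exact absurd (h ▸ Submodule.mem_sup_left (Submodule.mem_span_singleton_self w)) hwH
    · exact h
  have hspan : Submodule.span K (insert w s) = U := by
    rw [Submodule.span_insert, hsH, hsup]
  refine ⟨insert w s, hs.id_insert (by rwa [hsH]), hspan, fun a => ?_, fun a => ?_⟩
  · rcases (inf_le_left : U ⊓ P a ≤ U).lt_or_eq with h | h
    · refine le_trans (le_inf ((hD a h).trans hDH) inf_le_right) ((hsP a).trans ?_)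
      exact Submodule.span_mono (Set.inter_subset_inter_left _ (Set.subset_insert w s))
    · rw [h, Set.inter_eq_left.mpr, hspan]
      exact Submodule.span_le.mp (hspan.le.trans (inf_eq_left.mp h))
  · by_cases h : U ⊓ Q a ≤ H
    · refine le_trans (le_inf h inf_le_right) ((hsQ a).trans ?_)
      exact Submodule.span_mono (Set.inter_subset_inter_left _ (Set.subset_insert w s))
    · have hw := hwQ a h
      -- Modular law: as `w ∈ Q a`, the trace `U ⊓ Q a` is spanned by `w` and `H ⊓ Q a`.
      rw [← hsup, sup_inf_assoc_of_le _ ((Submodule.span_singleton_le_iff_mem _ _).mpr hw)]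
      refine sup_le ?_ ((hsQ a).trans ?_)
      · exact Submodule.span_mono (Set.singleton_subset_iff.mpr ⟨Set.mem_insert w s, hw⟩)
      · exact Submodule.span_mono (Set.inter_subset_inter_left _ (Set.subset_insert w s))

end AdaptedBasis

/-! ### Interval decompositions at the level of representatives -/

section PersistenceBasis

variable {K W ι : Type*} [Field K] [AddCommGroup W] [Module K W] [Fintype ι]

/-- The vectors `x i` represent generators, with lifetimes `bar i`, of the interval summands of the
persistence module `a ↦ Z a / B a`. -/
structure PersistenceBasis (Z B : ℝ → Submodule K W) (bar : ι → Bar) (x : ι → W) : Prop where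
  mem_birth : ∀ i, x i ∈ Z (bar i).birth
  mem_death : ∀ i (a : ℝ), (bar i).death ≤ a → x i ∈ B a
  span : ∀ a, ∀ z ∈ Z a, ∃ l : ι → K,
    (∀ i, l i ≠ 0 → (bar i).birth ≤ a ∧ (a : EReal) < (bar i).death) ∧ z - ∑ i, l i • x i ∈ B a
  indep : ∀ (a : ℝ) (l : ι → K),
    (∀ i, l i ≠ 0 → (bar i).birth ≤ a ∧ (a : EReal) < (bar i).death) →
    ∑ i, l i • x i ∈ B a → l = 0

/-- Terms of bars already dead at `a` lie in `B a` and can be dropped, so independence also applies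
to combinations that include them. -/
theorem PersistenceBasis.coeff_eq_zero {Z B : ℝ → Submodule K W} {bar : ι → Bar} {x : ι → W}
    (h : PersistenceBasis Z B bar x) {a : ℝ} {l : ι → K} (hl : ∀ i, l i ≠ 0 → (bar i).birth ≤ a)
    (hsum : ∑ i, l i • x i ∈ B a) (i : ι) (hi : (a : EReal) < (bar i).death) : l i = 0 := by
  classical
  have key : (fun j => if (a : EReal) < (bar j).death then l j else 0) = 0 := by
    refine h.indep a _ (fun j hj => ?_) ?_
    · by_cases hd : (a : EReal) < (bar j).death
      · rw [if_pos hd] at hj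
        exact ⟨hl j hj, hd⟩
      · rw [if_neg hd] at hj
        exact absurd rfl hj
    · have hdiff : ∑ j, l j • x j - ∑ j, (if (a : EReal) < (bar j).death then l j else 0) • x j
          ∈ B a := by
        rw [← Finset.sum_sub_distrib]
        refine Submodule.sum_mem _ fun j _ => ?_
        rw [← sub_smul]
        by_cases hd : (a : EReal) < (bar j).death
        · simp [hd]
        · exact Submodule.smul_mem _ _ (h.mem_death j a (not_lt.mp hd))
      simpa using Submodule.sub_mem _ hsum hdiff
  simpa [hi] using congrFun key i

theorem PersistenceBasis.comp_equiv {κ : Type*} [Fintype κ] {Z B : ℝ → Submodule K W}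
    {bar : ι → Bar} {x : ι → W} (h : PersistenceBasis Z B bar x) (e : κ ≃ ι) :
    PersistenceBasis Z B (bar ∘ e) (x ∘ e) where
  mem_birth i := h.mem_birth (e i)
  mem_death i := h.mem_death (e i)
  span a z hz := by
    obtain ⟨l, hl, hz⟩ := h.span a z hz
    refine ⟨l ∘ e, fun i => hl (e i), ?_⟩
    rwa [← e.sum_comp] at hz
  indep a l hl hsum := by
    have := h.indep a (l ∘ e.symm) (fun i hi => by simpa using hl (e.symm i) hi) (by
      rw [← e.sum_comp]; simpa using hsum)
    ext i
    simpa using congrFun this (e i)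

/-- The functions `z` and `d` say that each vector has a first moment of entry into each filtration,
which makes the intervals closed on the left and open on the right; `hbot` excludes births at `-∞`.
Vectors of the adapted basis with `d v ≤ z v` carry no homology and are discarded. -/
theorem exists_persistenceBasis [FiniteDimensional K W] {Z B : ℝ → Submodule K W} {z d : W → EReal}
    (hz : ∀ v (a : ℝ), v ∈ Z a ↔ z v ≤ a)
    (hd : ∀ v (a : ℝ), v ∈ B a ↔ d v ≤ a) (hbot : ∀ v, v ≠ 0 → z v ≠ ⊥) :
    ∃ (N : ℕ) (bar : Fin N → Bar) (x : Fin N → W), PersistenceBasis Z B bar x := by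
  have hZm : Monotone Z := fun a b hab v hv =>
    (hz v b).mpr (((hz v a).mp hv).trans (EReal.coe_le_coe_iff.mpr hab))
  have hBm : Monotone B := fun a b hab v hv =>
    (hd v b).mpr (((hd v a).mp hv).trans (EReal.coe_le_coe_iff.mpr hab))
  obtain ⟨s, hs, -, hsZ, hsB⟩ := exists_adapted_basis hZm hBm ⊤
  simp only [top_inf_eq] at hsZ hsB
  have hfin : s.Finite := hs.linearIndependent.setFinite
  let T : Set W := {v ∈ s | z v < d v}
  have : Fintype T := (hfin.subset (Set.sep_subset _ _)).fintype
  have h0 : ∀ v ∈ s, v ≠ 0 := fun v hv => hs.linearIndependent.ne_zero (⟨v, hv⟩ : s)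
  have hzr : ∀ v : T, ((z v).toReal : EReal) = z v := fun v =>
    EReal.coe_toReal (ne_top_of_lt v.2.2) (hbot v (h0 v v.2.1))
  let bar : T → Bar := fun v => ⟨(z v).toReal, d v, by rw [hzr]; exact v.2.2⟩
  have hbirth : ∀ (v : T) (a : ℝ), (bar v).birth ≤ a ↔ (v : W) ∈ Z a := fun v a => by
    rw [hz, ← hzr v, EReal.coe_le_coe_iff]
  have hdeath : ∀ (v : T) (a : ℝ), (bar v).death ≤ a ↔ (v : W) ∈ B a := fun v a => (hd v a).symm
  have key : PersistenceBasis Z B bar (fun v => (v : W)) := by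
    refine ⟨fun v => (hbirth v _).mp le_rfl, fun v a => (hdeath v a).mp, fun a y hy => ?_,
      fun a l hl hsum => ?_⟩
    · let A : Set T := {v | (bar v).birth ≤ a ∧ (a : EReal) < (bar v).death}
      have hle : Submodule.span K (s ∩ Z a) ≤ Submodule.span K ((fun v : T => (v : W)) '' A) ⊔ B a := by
        refine Submodule.span_le.mpr fun v hv => ?_
        by_cases hvB : v ∈ B a
        · exact Submodule.mem_sup_right hvB
        · have hlt : (a : EReal) < d v := not_le.mp fun h => hvB ((hd v a).mpr h)
          refine Submodule.mem_sup_left (Submodule.subset_span ?_)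
          refine ⟨⟨v, hv.1, ((hz v a).mp hv.2).trans_lt hlt⟩, ⟨?_, hlt⟩, rfl⟩
          exact (hbirth _ a).mpr hv.2
      obtain ⟨u, hu, b, hb, rfl⟩ := Submodule.mem_sup.mp (hle (hsZ a hy))
      obtain ⟨l, hl, rfl⟩ := (Finsupp.mem_span_image_iff_linearCombination K).mp hu
      refine ⟨l, fun v hv => hl (Finsupp.mem_support_iff.mpr hv), ?_⟩
      rw [Finsupp.linearCombination_apply, Finsupp.sum_fintype l (fun v c => c • (v : W)) fun v => zero_smul K (v : W)]
      simpa using hb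
    · have hT : LinearIndependent K (fun v : T => (v : W)) :=
        (hs.mono (Set.sep_subset _ _)).linearIndependent
      -- Adaptedness to `B` puts an element of `B a` in the span of the basis vectors inside `B a`,
      -- which is independent of the span of the others, among them all living generators.
      have hdis : Disjoint (Submodule.span K (s \ B a)) (Submodule.span K (s ∩ B a)) := by
        have := hs.linearIndependent.disjoint_span_image (s := {v | (v : W) ∉ B a})
          (t := {v | (v : W) ∈ B a}) (Set.disjoint_left.mpr fun _ h h' => h h')
        refine this.mono (Submodule.span_mono ?_) (Submodule.span_mono ?_)
        · exact fun v hv => ⟨⟨v, hv.1⟩, hv.2, rfl⟩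
        · exact fun v hv => ⟨⟨v, hv.1⟩, hv.2, rfl⟩
      have hmem : ∑ v, l v • (v : W) ∈ Submodule.span K (s \ B a) := by
        refine Submodule.sum_mem _ fun v _ => ?_
        by_cases hv : l v = 0
        · simp [hv]
        · refine Submodule.smul_mem _ _ (Submodule.subset_span ⟨v.2.1, fun h => ?_⟩)
          exact (hl v hv).2.not_ge ((hdeath v a).mpr h)
      have hzero := Submodule.disjoint_def.mp hdis _ hmem (hsB a hsum)
      exact funext (Fintype.linearIndependent_iff.mp hT l hzero)
  exact ⟨_, _, _, key.comp_equiv (Fintype.equivFin T).symm⟩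

end PersistenceBasis

/-! ### Combinatorics of bars -/

section Bars

theorem Bar.death_ne_bot (β : Bar) : β.death ≠ ⊥ :=
  ne_bot_of_gt β.birth_lt_death

theorem Bar.coe_toReal_death {β : Bar} (h : β.death ≠ ⊤) : ((β.death.toReal : ℝ) : EReal) = β.death :=
  EReal.coe_toReal h β.death_ne_bot

/-- Births and deaths of two bars differ by at most `ε`. -/
def Bar.Close (ε : ℝ) (β γ : Bar) : Prop :=
  |β.birth - γ.birth| ≤ ε ∧ β.death ≤ γ.death + ε ∧ γ.death ≤ β.death + ε

/-- A bar is `ε`-long if its length is more than `2 * ε`. -/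
def Bar.Long (ε : ℝ) (β : Bar) : Prop :=
  ((β.birth + 2 * ε : ℝ) : EReal) < β.death

/-- The necessary condition for a nonzero map of degree `ε` between interval modules. -/
def Bar.Hom (ε : ℝ) (β γ : Bar) : Prop :=
  γ.birth ≤ β.birth + ε ∧ γ.death ≤ β.death + ε

/-- Bars ordered by midpoints, the infinite bars coming last. -/
def Bar.key (β : Bar) : ℕ ×ₗ ℝ :=
  toLex (if β.death = ⊤ then 1 else 0, β.birth + β.death.toReal)

theorem Bar.Close.symm {ε : ℝ} {β γ : Bar} (h : β.Close ε γ) : γ.Close ε β :=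
  ⟨abs_sub_comm β.birth γ.birth ▸ h.1, h.2.2, h.2.1⟩

theorem Bar.key_le_iff {β γ : Bar} : β.key ≤ γ.key ↔
    (β.death ≠ ⊤ ∧ γ.death = ⊤) ∨
      ((β.death = ⊤ ↔ γ.death = ⊤) ∧ β.birth + β.death.toReal ≤ γ.birth + γ.death.toReal) := by
  rw [Bar.key, Bar.key, Prod.Lex.toLex_le_toLex]
  by_cases h : β.death = ⊤ <;> by_cases h' : γ.death = ⊤ <;> simp [h, h']

/-- Of two bars linked by maps of degree `ε` through a third one, in ascending order, one is close
to the third one. -/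
theorem Bar.Hom.close_or_close {ε : ℝ} {β γ β' : Bar} (h : β.Hom ε γ) (h' : γ.Hom ε β')
    (hk : β.key ≤ β'.key) : β.Close ε γ ∨ β'.Close ε γ := by
  obtain ⟨b, d, hb⟩ := β
  obtain ⟨b', d', hb'⟩ := β'
  obtain ⟨c, e, hc⟩ := γ
  rw [Bar.key_le_iff] at hk
  simp only [Bar.Hom, Bar.Close, abs_le] at *
  have htop : ∀ r : ℝ, ¬ (⊤ : EReal) ≤ r + ε := fun r => (EReal.coe_lt_top (r + ε)).not_ge
  by_contra! hcon
  obtain ⟨hcon, hcon'⟩ := hcon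
  induction d using EReal.rec with
  | bot => simp at hb
  | coe d =>
    induction e using EReal.rec with
    | bot => simp at hc
    | top => exact absurd h.2 (htop d)
    | coe e =>
      induction d' using EReal.rec with
      | bot => simp at hb'
      | top => exact absurd h'.2 (htop e)
      | coe d' =>
        simp only [← EReal.coe_add, EReal.coe_le_coe_iff, EReal.coe_lt_coe_iff, EReal.toReal_coe,
          EReal.coe_ne_top, iff_self, true_and, and_false, false_or] at *
        -- With both endpoints of `γ` at most `ε` above those of `β`, an endpoint sum no smaller
        -- than that of `β` would force closeness.
        have h1 : c + e < b + d := by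
          by_contra! hh
          linarith [hcon ⟨by linarith, by linarith⟩ (by linarith)]
        have h2 : b' + d' < c + e := by
          by_contra! hh
          linarith [hcon' ⟨by linarith, by linarith⟩ (by linarith)]
        linarith
  | top =>
    obtain rfl : d' = ⊤ := by
      by_contra hne
      simp [hne] at hk
    obtain rfl : e = ⊤ := by
      induction e using EReal.rec with
      | bot => simp at hc
      | coe e => exact absurd h'.2 (htop e)
      | top => rfl
    -- As `⊤.toReal = 0`, the keys of infinite bars compare births.
    have hbb : b ≤ b' := by simpa using hk
    by_cases h1 : b - c ≤ ε
    · exact not_top_lt ((hcon ⟨by linarith [h.1], h1⟩ (by simp)).trans_le' (by simp))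
    · exact not_top_lt ((hcon' ⟨by linarith, by linarith [h'.1]⟩ (by simp)).trans_le' (by simp))

/-- If `γ` is born no earlier than `β`, its own length suffices; otherwise the order of midpoints
makes it die no earlier. Thus `γ` is still alive when the `2ε`-shift of the generator of `β` is
expanded. -/
theorem Bar.Long.lt_death_of_key_le {ε : ℝ} {β γ : Bar} (hβ : β.Long ε) (hγ : γ.Long ε)
    (hk : β.key ≤ γ.key) : ((β.birth + 2 * ε : ℝ) : EReal) < γ.death := by
  rw [Bar.key_le_iff] at hk
  rcases le_total β.birth γ.birth with h | h
  · exact lt_of_le_of_lt (EReal.coe_le_coe_iff.mpr (by linarith)) hγ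
  · refine lt_of_lt_of_le hβ ?_
    by_cases hγ' : γ.death = ⊤
    · simp [hγ']
    · have hk' := hk.resolve_left fun h => hγ' h.2
      have hβ' : β.death ≠ ⊤ := fun h => hγ' (hk'.1.mp h)
      rw [← Bar.coe_toReal_death hβ', ← Bar.coe_toReal_death hγ', EReal.coe_le_coe_iff]
      linarith

end Bars

/-! ### Algebraic stability via Hall's theorem -/

section Stability

variable {K W ι κ : Type*} [Field K] [AddCommGroup W] [Module K W] [Fintype ι] [Fintype κ]
  {Z B Z' B' : ℝ → Submodule K W} {bar : ι → Bar} {bar' : κ → Bar} {x : ι → W} {y : κ → W} {ε : ℝ}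

/-- The matrix of the map of degree `ε` between two persistence modules that is induced by
inclusions. -/
theorem PersistenceBasis.exists_transition (h : PersistenceBasis Z B bar x)
    (h' : PersistenceBasis Z' B' bar' y) (hB' : Monotone B') (hZZ : ∀ a, Z a ≤ Z' (a + ε))
    (hBB : ∀ a, B a ≤ B' (a + ε)) :
    ∃ F : ι → κ → K, (∀ i j, F i j ≠ 0 → (bar i).Hom ε (bar' j)) ∧
      ∀ i, x i - ∑ j, F i j • y j ∈ B' ((bar i).birth + ε) := by
  choose F hF hFB using fun i => h'.span ((bar i).birth + ε) (x i) (hZZ _ (h.mem_birth i))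
  refine ⟨F, fun i j hij => ⟨(hF i j hij).1, ?_⟩, hFB⟩
  by_contra! hlt
  have htop : (bar i).death ≠ ⊤ := fun hd => by simp [hd] at hlt
  have hd := Bar.coe_toReal_death htop
  set d := (bar i).death.toReal
  rw [← hd, ← EReal.coe_add] at hlt
  have hbd : (bar i).birth ≤ d := by
    rw [← EReal.coe_le_coe_iff, hd]; exact (bar i).birth_lt_death.le
  -- At `d + ε` the image of `x i` is already a boundary, so a bar alive there has coefficient zero.
  refine hij (h'.coeff_eq_zero (fun j hj => (hF i j hj).1.trans (by linarith)) ?_ j hlt)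
  have := Submodule.sub_mem _ (hBB d (h.mem_death i d hd.symm.le))
    (hB' (by linarith : (bar i).birth + ε ≤ d + ε) (hFB i))
  simpa using this

/-- Hall's condition: `r` long bars are close to at least `r` bars of an interleaved barcode. -/
theorem PersistenceBasis.card_le [DecidableEq κ] [∀ β γ, Decidable (Bar.Close ε β γ)]
    (h : PersistenceBasis Z B bar x)
    (h' : PersistenceBasis Z' B' bar' y) (hB : Monotone B) (hB' : Monotone B')
    (hZZ : ∀ a, Z a ≤ Z' (a + ε)) (hBB : ∀ a, B a ≤ B' (a + ε))
    (hZZ' : ∀ a, Z' a ≤ Z (a + ε)) (hBB' : ∀ a, B' a ≤ B (a + ε))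
    (hε : 0 ≤ ε) (A : Finset ι) (hA : ∀ i ∈ A, (bar i).Long ε) :
    A.card ≤ (A.biUnion fun i => Finset.univ.filter fun j => (bar i).Close ε (bar' j)).card := by
  classical
  obtain ⟨F, hF, hFB⟩ := h.exists_transition h' hB' hZZ hBB
  obtain ⟨G, hG, hGB⟩ := h'.exists_transition h hB hZZ' hBB'
  -- Modulo boundaries, going over and back is the inclusion of degree `2ε`.
  have hcomp : ∀ i, x i - ∑ i', (∑ j, F i j * G j i') • x i' ∈ B ((bar i).birth + 2 * ε) := by
    intro i
    have h1 : ∑ j, F i j • (y j - ∑ i', G j i' • x i') ∈ B ((bar i).birth + 2 * ε) := by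
      refine Submodule.sum_mem _ fun j _ => ?_
      by_cases hij : F i j = 0
      · simp [hij]
      · exact Submodule.smul_mem _ _ (hB (by linarith [(hF i j hij).1]) (hGB j))
    have h2 : x i - ∑ j, F i j • y j ∈ B ((bar i).birth + 2 * ε) := by
      have := hBB' _ (hFB i)
      rwa [add_assoc, ← two_mul] at this
    convert Submodule.add_mem _ h2 h1 using 1
    simp only [smul_sub, Finset.sum_sub_distrib, Finset.smul_sum, Finset.sum_smul, mul_smul]
    rw [Finset.sum_comm]
    abel
  have hdelta : ∀ i i', (((bar i).birth + 2 * ε : ℝ) : EReal) < (bar i').death →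
      ∑ j, F i j * G j i' = if i = i' then 1 else 0 := by
    intro i i' hlt
    refine (sub_eq_zero.mp (h.coeff_eq_zero (a := (bar i).birth + 2 * ε)
      (l := fun i' => (if i = i' then 1 else 0) - ∑ j, F i j * G j i')
      (fun i' hi' => ?_) ?_ i' hlt)).symm
    · by_cases hii : i = i'
      · rw [hii]; linarith
      · rw [if_neg hii, zero_sub, neg_ne_zero] at hi'
        obtain ⟨j, -, hj⟩ := Finset.exists_ne_zero_of_sum_ne_zero hi'
        linarith [(hF i j (left_ne_zero_of_mul hj)).1, (hG j i' (right_ne_zero_of_mul hj)).1]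
    · simpa [sub_smul] using hcomp i
  set μ := A.biUnion fun i => Finset.univ.filter fun j => (bar i).Close ε (bar' j) with hμ
  by_contra! hcard
  -- With fewer columns `μ` than rows `A`, the block of `F` has a nonzero row relation `l`. It is
  -- tested against the row of largest key in its support, where it must vanish.
  let φ : (A → K) →ₗ[K] (μ → K) :=
    { toFun := fun l j => ∑ i, l i * F i j
      map_add' := fun l l' => by ext j; simp [add_mul, Finset.sum_add_distrib]
      map_smul' := fun c l => by ext j; simp [mul_assoc, Finset.mul_sum] }
  obtain ⟨l, hl, hl0⟩ := (Submodule.ne_bot_iff _).mp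
    (LinearMap.ker_ne_bot_of_finrank_lt (f := φ) (by simpa using hcard))
  obtain ⟨i', hi', hmax⟩ := Finset.exists_max_image (Finset.univ.filter fun i => l i ≠ 0)
    (fun i => (bar i).key) (by
      obtain ⟨i, hi⟩ := Function.ne_iff.mp hl0
      exact ⟨i, by simpa using hi⟩)
  simp only [Finset.mem_filter, Finset.mem_univ, true_and] at hi' hmax
  refine hi' ?_
  have hrow : ∑ i : A, l i * ∑ j : μ, F i j * G j i' = 0 := by
    have : ∀ j : μ, ∑ i, l i * F i j = 0 := fun j => congrFun (LinearMap.mem_ker.mp hl) j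
    simp only [Finset.mul_sum, ← mul_assoc]
    rw [Finset.sum_comm]
    simp only [← Finset.sum_mul, this, zero_mul, Finset.sum_const_zero]
  -- A nonzero term through `j` makes `j` close to `i` or `i'` by the order of keys, so restricting
  -- the sum to `μ` loses nothing.
  have hsum : ∀ i : A, l i ≠ 0 → ∑ j : μ, F i j * G j i' = if i = i' then 1 else 0 := by
    intro i hi
    have hlong := (hA i i.2).lt_death_of_key_le (hA i' i'.2) (hmax i hi)
    rw [Finset.sum_coe_sort μ fun j => F i j * G j i', Finset.sum_subset (Finset.subset_univ μ),
      hdelta i i' hlong]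
    · simp only [Subtype.ext_iff]
    · intro j _ hj
      by_contra hne
      refine hj ?_
      simp only [hμ, Finset.mem_biUnion, Finset.mem_filter, Finset.mem_univ, true_and]
      rcases (hF i j (left_ne_zero_of_mul hne)).close_or_close
        (hG j i' (right_ne_zero_of_mul hne)) (hmax i hi) with hc | hc
      · exact ⟨i, i.2, hc⟩
      · exact ⟨i', i'.2, hc⟩
  rw [Finset.sum_eq_single i', hsum i' hi', if_pos rfl, mul_one] at hrow
  · exact hrow
  · intro i _ hne
    by_cases hi : l i = 0
    · rw [hi, zero_mul]
    · rw [hsum i hi, if_neg hne, mul_zero]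
  · exact fun h => absurd (Finset.mem_univ i') h

/-- The algebraic stability theorem: a bijection of padded index sets that matches long bars of
interleaved barcodes with close bars. -/
theorem PersistenceBasis.exists_matching (h : PersistenceBasis Z B bar x)
    (h' : PersistenceBasis Z' B' bar' y) (hB : Monotone B) (hB' : Monotone B')
    (hZZ : ∀ a, Z a ≤ Z' (a + ε)) (hBB : ∀ a, B a ≤ B' (a + ε))
    (hZZ' : ∀ a, Z' a ≤ Z (a + ε)) (hBB' : ∀ a, B' a ≤ B (a + ε)) (hε : 0 ≤ ε) :
    ∃ e : ι ⊕ ℕ ≃ κ ⊕ ℕ, (∀ i j, e (.inl i) = .inl j → (bar i).Close ε (bar' j)) ∧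
      (∀ i n, e (.inl i) = .inr n → ¬ (bar i).Long ε) ∧
      ∀ n j, e (.inr n) = .inl j → ¬ (bar' j).Long ε := by
  classical
  obtain ⟨f, hf, hfc⟩ := (Finset.all_card_le_biUnion_card_iff_exists_injective
    (fun i : {i // (bar i).Long ε} => Finset.univ.filter fun j => (bar i).Close ε (bar' j))).mp
    fun s => by
      have := h.card_le h' hB hB' hZZ hBB hZZ' hBB' hε (s.map (.subtype _)) (by simp +contextual)
      rwa [Finset.card_map, Finset.map_eq_image, Finset.image_biUnion] at this
  obtain ⟨g, hg, hgc⟩ := (Finset.all_card_le_biUnion_card_iff_exists_injective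
    (fun j : {j // (bar' j).Long ε} => Finset.univ.filter fun i => (bar' j).Close ε (bar i))).mp
    fun s => by
      have := h'.card_le h hB' hB hZZ' hBB' hZZ hBB hε (s.map (.subtype _)) (by simp +contextual)
      rwa [Finset.card_map, Finset.map_eq_image, Finset.image_biUnion] at this
  simp only [Finset.mem_filter, Finset.mem_univ, true_and] at hfc hgc
  let R : ι ⊕ ℕ → κ ⊕ ℕ → Prop
    | .inl i, .inl j => (bar i).Close ε (bar' j)
    | .inl i, .inr _ => ¬ (bar i).Long ε
    | .inr _, .inl j => ¬ (bar' j).Long ε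
    | .inr _, .inr _ => True
  -- Long bars follow Hall's injection, the others go to the first natural numbers, and the padding
  -- is shifted to make room for them.
  let p : ι ⊕ ℕ → κ ⊕ ℕ
    | .inl i => if hi : (bar i).Long ε then .inl (f ⟨i, hi⟩) else .inr (Fintype.equivFin ι i)
    | .inr n => .inr (n + Fintype.card ι)
  let q : κ ⊕ ℕ → ι ⊕ ℕ
    | .inl j => if hj : (bar' j).Long ε then .inl (g ⟨j, hj⟩) else .inr (Fintype.equivFin κ j)
    | .inr n => .inr (n + Fintype.card κ)
  have hp : Function.Injective p := by
    rintro (i | n) (i' | n') hii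
    · by_cases hi : (bar i).Long ε <;> by_cases hi' : (bar i').Long ε <;>
        simp [p, hi, hi', hf.eq_iff, Fin.val_inj] at hii ⊢
      all_goals exact hii
    · by_cases hi : (bar i).Long ε <;> simp [p, hi] at hii
      have := (Fintype.equivFin ι i).2
      omega
    · by_cases hi : (bar i').Long ε <;> simp [p, hi] at hii
      have := (Fintype.equivFin ι i').2
      omega
    · simpa [p] using hii
  have hq : Function.Injective q := by
    rintro (i | n) (i' | n') hii
    · by_cases hi : (bar' i).Long ε <;> by_cases hi' : (bar' i').Long ε <;>
        simp [q, hi, hi', hg.eq_iff, Fin.val_inj] at hii ⊢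
      all_goals exact hii
    · by_cases hi : (bar' i).Long ε <;> simp [q, hi] at hii
      have := (Fintype.equivFin κ i).2
      omega
    · by_cases hi : (bar' i').Long ε <;> simp [q, hi] at hii
      have := (Fintype.equivFin κ i').2
      omega
    · simpa [q] using hii
  -- Each pair of the bijection comes from `p` or from `q`, so the relation `R`, valid along both,
  -- survives.
  obtain ⟨e, he, hR⟩ := Function.Embedding.schroeder_bernstein_of_rel hp hq R
    (by
      rintro (i | n)
      · by_cases hi : (bar i).Long ε
        · simpa [p, R, hi] using hfc ⟨i, hi⟩
        · simp [p, R, hi]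
      · simp [p, R])
    (by
      rintro (j | n)
      · by_cases hj : (bar' j).Long ε
        · simpa [q, R, hj] using (hgc ⟨j, hj⟩).symm
        · simp [q, R, hj]
      · simp [q, R])
  refine ⟨Equiv.ofBijective e he, fun i j hij => ?_, fun i n hin => ?_, fun n j hnj => ?_⟩
  · have := hR (.inl i)
    rwa [show e (.inl i) = .inl j from hij] at this
  · have := hR (.inl i)
    rwa [show e (.inl i) = .inr n from hin] at this
  · have := hR (.inr n)
    rwa [show e (.inr n) = .inl j from hnj] at this

end Stability

/-! ### From bijections to the bottleneck distance -/

section Matching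

variable {ι κ : Type*} [Fintype ι] [Fintype κ] {ε : ℝ}

theorem map_univ_eq_sum_singleton (bar : ι → Bar) :
    Finset.univ.val.map bar = ∑ i, ({bar i} : Multiset Bar) := by
  rw [← Multiset.sum_map_singleton (Finset.univ.val.map bar), Multiset.map_map]
  rfl

/-- A bar sent to or coming from the padding is unmatched; pairs of padding elements are ignored.
Sums over the finite index sets keep track of multiplicities. -/
theorem exists_multiset_matching (bar : ι → Bar) (bar' : κ → Bar) (e : ι ⊕ ℕ ≃ κ ⊕ ℕ) :
    ∃ (M : Multiset (Bar × Bar)) (U U' : Multiset Bar),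
      M.map Prod.fst + U = Finset.univ.val.map bar ∧
      M.map Prod.snd + U' = Finset.univ.val.map bar' ∧
      (∀ p ∈ M, ∃ i j, e (.inl i) = .inl j ∧ (bar i, bar' j) = p) ∧
      (∀ b ∈ U, ∃ i n, e (.inl i) = .inr n ∧ bar i = b) ∧
      ∀ b ∈ U', ∃ n j, e (.inr n) = .inl j ∧ bar' j = b := by
  classical
  refine ⟨∑ i, ∑ j, if e (.inl i) = .inl j then {(bar i, bar' j)} else 0,
    ∑ i, if (e (.inl i)).isRight then {bar i} else 0,
    ∑ j, if (e.symm (.inl j)).isRight then {bar' j} else 0, ?_, ?_, ?_, ?_, ?_⟩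
  · rw [← Multiset.coe_mapAddMonoidHom, map_sum, ← Finset.sum_add_distrib, map_univ_eq_sum_singleton]
    refine Finset.sum_congr rfl fun i _ => ?_
    rw [map_sum]
    rcases e (.inl i) with j | n <;> simp [apply_ite]
  · rw [← Multiset.coe_mapAddMonoidHom, map_sum]
    simp_rw [map_sum]
    rw [Finset.sum_comm, ← Finset.sum_add_distrib, map_univ_eq_sum_singleton]
    refine Finset.sum_congr rfl fun j _ => ?_
    simp_rw [← Equiv.eq_symm_apply]
    rcases e.symm (.inl j) with i | n <;> simp [apply_ite]
  · intro p hp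
    simp only [Multiset.mem_sum, Finset.mem_univ, true_and] at hp
    obtain ⟨i, j, hp⟩ := hp
    split_ifs at hp with h
    · exact ⟨i, j, h, (Multiset.mem_singleton.mp hp).symm⟩
    · simp at hp
  · intro b hb
    simp only [Multiset.mem_sum, Finset.mem_univ, true_and] at hb
    obtain ⟨i, hb⟩ := hb
    split_ifs at hb with h
    · obtain ⟨n, hn⟩ := Sum.isRight_iff.mp h
      exact ⟨i, n, hn, (Multiset.mem_singleton.mp hb).symm⟩
    · simp at hb
  · intro b hb
    simp only [Multiset.mem_sum, Finset.mem_univ, true_and] at hb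
    obtain ⟨j, hb⟩ := hb
    split_ifs at hb with h
    · obtain ⟨n, hn⟩ := Sum.isRight_iff.mp h
      exact ⟨n, j, by rw [← hn, e.apply_symm_apply], (Multiset.mem_singleton.mp hb).symm⟩
    · simp at hb

theorem Bar.Close.eq {β γ : Bar} (h : β.Close 0 γ) : β = γ := by
  obtain ⟨b, d, _⟩ := β
  obtain ⟨c, e, _⟩ := γ
  obtain ⟨h1, h2, h3⟩ := h
  simp only [EReal.coe_zero, add_zero] at h1 h2 h3
  obtain rfl : b = c := sub_eq_zero.mp (abs_nonpos_iff.mp h1)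
  obtain rfl := le_antisymm h2 h3
  rfl

theorem Bar.long_zero (β : Bar) : β.Long 0 := by
  simpa [Bar.Long] using β.birth_lt_death

theorem Bar.Close.barDist_le {β γ : Bar} (h : β.Close ε γ) : barDist β γ ≤ ENNReal.ofReal ε := by
  obtain ⟨h1, h2, h3⟩ := h
  refine max_le ?_ ?_
  · rw [edist_dist, Real.dist_eq]
    exact ENNReal.ofReal_le_ofReal h1
  · rw [deathDist]
    split_ifs with heq
    · exact zero_le
    · have hβ : β.death ≠ ⊤ := fun hβ => heq <| by
        by_contra hne
        have hγ : γ.death ≠ ⊤ := fun h => hne (hβ.trans h.symm)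
        rw [hβ, ← Bar.coe_toReal_death hγ, ← EReal.coe_add, top_le_iff] at h2
        exact EReal.coe_ne_top _ h2
      have hγ : γ.death ≠ ⊤ := fun hγ => by
        rw [hγ, ← Bar.coe_toReal_death hβ, ← EReal.coe_add, top_le_iff] at h3
        exact EReal.coe_ne_top _ h3
      rw [← Bar.coe_toReal_death hβ, ← Bar.coe_toReal_death hγ, ← EReal.coe_add,
        EReal.coe_le_coe_iff] at h2 h3
      rw [← Bar.coe_toReal_death hβ, ← Bar.coe_toReal_death hγ, ← EReal.coe_sub, EReal.abs_def]
      exact ENNReal.ofReal_le_ofReal (abs_le.mpr ⟨by linarith, by linarith⟩)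

theorem Bar.diagDist_le {β : Bar} (h : ¬ β.Long ε) : diagDist β ≤ ENNReal.ofReal ε := by
  rw [Bar.Long, not_lt] at h
  have hβ : β.death ≠ ⊤ := fun hβ => by
    rw [hβ, top_le_iff] at h
    exact EReal.coe_ne_top _ h
  have hlt := β.birth_lt_death
  rw [← Bar.coe_toReal_death hβ] at h hlt
  rw [EReal.coe_le_coe_iff] at h
  rw [EReal.coe_lt_coe_iff] at hlt
  rw [diagDist, ← Bar.coe_toReal_death hβ, ← EReal.coe_sub, EReal.abs_def,
    abs_of_pos (sub_pos.mpr hlt)]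
  refine ENNReal.div_le_of_le_mul ?_
  rw [← ENNReal.ofReal_ofNat 2, ← ENNReal.ofReal_mul (by linarith)]
  exact ENNReal.ofReal_le_ofReal (by linarith)

variable {K W : Type*} [Field K] [AddCommGroup W] [Module K W]
  {Z B Z' B' : ℝ → Submodule K W} {bar : ι → Bar} {bar' : κ → Bar} {x : ι → W} {y : κ → W}

theorem PersistenceBasis.bottleneckDist_le (h : PersistenceBasis Z B bar x)
    (h' : PersistenceBasis Z' B' bar' y) (hB : Monotone B) (hB' : Monotone B')
    (hZZ : ∀ a, Z a ≤ Z' (a + ε)) (hBB : ∀ a, B a ≤ B' (a + ε))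
    (hZZ' : ∀ a, Z' a ≤ Z (a + ε)) (hBB' : ∀ a, B' a ≤ B (a + ε)) (hε : 0 ≤ ε) :
    bottleneckDist (Finset.univ.val.map bar) (Finset.univ.val.map bar') ≤ ENNReal.ofReal ε := by
  obtain ⟨e, he, heU, heU'⟩ := h.exists_matching h' hB hB' hZZ hBB hZZ' hBB' hε
  obtain ⟨M, U, U', hM, hM', hMe, hU, hU'⟩ := exists_multiset_matching bar bar' e
  refine sInf_le ⟨M, U, U', hM, hM', fun p hp => ?_, fun b hb => ?_, fun b hb => ?_⟩
  · obtain ⟨i, j, hij, rfl⟩ := hMe p hp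
    exact (he i j hij).barDist_le
  · obtain ⟨i, n, hin, rfl⟩ := hU b hb
    exact Bar.diagDist_le (heU i n hin)
  · obtain ⟨n, j, hnj, rfl⟩ := hU' b hb
    exact Bar.diagDist_le (heU' n j hnj)

/-- A module is `0`-interleaved with itself. Bars are nonempty, hence `0`-long, so none is
unmatched, and `0`-close bars coincide. -/
theorem PersistenceBasis.map_bar_eq (h : PersistenceBasis Z B bar x)
    (h' : PersistenceBasis Z B bar' y) (hB : Monotone B) :
    Finset.univ.val.map bar = Finset.univ.val.map bar' := by
  obtain ⟨e, he, heU, heU'⟩ := h.exists_matching h' (ε := 0) hB hB (by simp) (by simp) (by simp)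
    (by simp) le_rfl
  obtain ⟨M, U, U', hM, hM', hMe, hU, hU'⟩ := exists_multiset_matching bar bar' e
  have hU0 : U = 0 := Multiset.eq_zero_of_forall_notMem fun b hb => by
    obtain ⟨i, n, hin, rfl⟩ := hU b hb
    exact heU i n hin (bar i).long_zero
  have hU0' : U' = 0 := Multiset.eq_zero_of_forall_notMem fun b hb => by
    obtain ⟨n, j, hnj, rfl⟩ := hU' b hb
    exact heU' n j hnj (bar' j).long_zero
  rw [← hM, ← hM', hU0, hU0', add_zero, add_zero]
  refine Multiset.map_congr rfl fun p hp => ?_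
  obtain ⟨i, j, hij, rfl⟩ := hMe p hp
  exact (he i j hij).eq

end Matching

/-! ### Barcodes of Vietoris-Rips filtrations -/

section Barcode

variable {V : Type*}

theorem vietorisRips_le_of_le_add {m m' : Matrix V V EReal} {ε : ℝ}
    (h : ∀ i j, m' i j ≤ m i j + ε) (a : ℝ) : vietorisRips m a ≤ vietorisRips m' (a + ε) :=
  fun _ hσ => ⟨hσ.1, fun i hi j hj => (h i j).trans (by
    rw [EReal.coe_add]
    exact add_le_add_left (hσ.2 i hi j hj) _)⟩

variable [Fintype V]

/-- The threshold from which on a chain belongs to the Vietoris-Rips complex. -/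
def chainWeight (m : Matrix V V EReal) (k : ℕ) (x : Finset V → ZMod 2) : EReal :=
  (Finset.univ.filter fun σ => x σ ≠ 0).sup fun σ =>
    if σ.card = k + 1 then σ.sup fun i => σ.sup fun j => m i j else ⊤

theorem mem_chains_vietorisRips {m : Matrix V V EReal} {k : ℕ} {x : Finset V → ZMod 2} {a : ℝ} :
    x ∈ chains (vietorisRips m a) k ↔ chainWeight m k x ≤ a := by
  simp only [chainWeight, Finset.sup_le_iff, Finset.mem_filter, Finset.mem_univ, true_and]
  refine forall₂_congr fun σ _ => ?_
  by_cases hc : σ.card = k + 1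
  · have hne : σ.Nonempty := Finset.card_pos.mp (by omega)
    simp only [hc, if_true, and_true, Finset.sup_le_iff]
    exact ⟨fun h => h.2, fun h => ⟨hne, h⟩⟩
  · simp [hc]

variable [DecidableEq V]

theorem boundaries_mono {K L : PreAbstractSimplicialComplex V} (h : K ≤ L) (k : ℕ) :
    boundaries K k ≤ boundaries L k :=
  Submodule.map_mono (chains_mono h (k + 1))

theorem sum_subtype_smul {R W ι : Type*} [Semiring R] [AddCommMonoid W] [Module R W] [Fintype ι]
    {p : ι → Prop} [Fintype {i // p i}] {l : ι → R} (hl : ∀ i, l i ≠ 0 → p i) (x : ι → W) :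
    ∑ i : {i // p i}, l i • x i = ∑ i, l i • x i := by
  classical
  rw [← Finset.sum_subtype (Finset.univ.filter p) (by simp) fun i => l i • x i]
  refine Finset.sum_filter_of_ne fun i _ h => hl i fun h0 => h ?_
  rw [h0, zero_smul]

theorem homologyMap_mk {K L : PreAbstractSimplicialComplex V} (h : K ≤ L) (k : ℕ)
    (x : Finset V → ZMod 2) (hx : x ∈ cycles K k) :
    homologyMap h k (Submodule.Quotient.mk ⟨x, hx⟩) =
      Submodule.Quotient.mk ⟨x, cycles_mono h k hx⟩ := rfl

theorem sum_smul_mk {K : PreAbstractSimplicialComplex V} {k : ℕ} {ι : Type*} [Fintype ι]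
    (g : ι → ZMod 2) (x : ι → Finset V → ZMod 2) (hx : ∀ i, x i ∈ cycles K k) :
    ∑ i, g i • (Submodule.Quotient.mk ⟨x i, hx i⟩ : Homology K k) =
      Submodule.Quotient.mk
        ⟨∑ i, g i • x i, Submodule.sum_mem _ fun i _ => Submodule.smul_mem _ _ (hx i)⟩ := by
  have : (⟨∑ i, g i • x i, Submodule.sum_mem _ fun i _ => Submodule.smul_mem _ _ (hx i)⟩ :
      cycles K k) = ∑ i, g i • ⟨x i, hx i⟩ := by
    ext1
    simp
  rw [this]
  exact (map_sum (Submodule.mkQ ((boundaries K k).submoduleOf (cycles K k))) _ _).symm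

/-- The dictionary between homology classes and cycle representatives: vanishing in homology is
membership in the boundaries. -/
theorem persistenceBasis_iff {m : Matrix V V EReal} {k : ℕ} {ι : Type*} [Fintype ι]
    {bar : ι → Bar} {x : ι → Finset V → ZMod 2}
    (hx : ∀ i, x i ∈ cycles (vietorisRips m (bar i).birth) k) :
    PersistenceBasis (fun a => cycles (vietorisRips m a) k)
        (fun a => boundaries (vietorisRips m a) k) bar x ↔
      (∀ (i : ι) (α : ℝ) (h : (bar i).birth ≤ α), (bar i).death ≤ α →
        homologyMap (vietorisRips_mono m h) k (Submodule.Quotient.mk ⟨x i, hx i⟩) = 0) ∧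
      ∀ α : ℝ,
        let e : {i : ι // (bar i).birth ≤ α ∧ (α : EReal) < (bar i).death} →
            Homology (vietorisRips m α) k :=
          fun i => homologyMap (vietorisRips_mono m i.2.1) k (Submodule.Quotient.mk ⟨x i.1, hx i.1⟩)
        LinearIndependent (ZMod 2) e ∧ Submodule.span (ZMod 2) (Set.range e) = ⊤ := by
  classical
  have hb : ∀ {i : ι} {a : ℝ}, (bar i).death ≤ a → (bar i).birth ≤ a := fun {i a} h =>
    EReal.coe_le_coe_iff.mp ((bar i).birth_lt_death.le.trans h)
  -- Coefficients on the living bars, extended by zero to all bars.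
  let ext (a : ℝ) (g : {i : ι // (bar i).birth ≤ a ∧ (a : EReal) < (bar i).death} → ZMod 2)
      (i : ι) : ZMod 2 := if h : _ then g ⟨i, h⟩ else 0
  have hext : ∀ a g, ∀ i, ext a g i ≠ 0 → (bar i).birth ≤ a ∧ (a : EReal) < (bar i).death := by
    intro a g i hi
    by_contra h
    exact hi (dif_neg h)
  have hsum : ∀ a g, ∑ i, g i • x i.1 = ∑ i, ext a g i • x i := fun a g => by
    rw [← sum_subtype_smul (hext a g)]
    refine Finset.sum_congr rfl fun i _ => ?_
    simp only [ext, dif_pos i.2]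
  constructor
  · intro h
    refine ⟨fun i a hbi hdi => ?_, fun a => ⟨?_, ?_⟩⟩
    · rw [homologyMap_mk, Submodule.Quotient.mk_eq_zero]
      exact h.mem_death i a hdi
    · rw [Fintype.linearIndependent_iff]
      intro g hg i
      simp only [homologyMap_mk] at hg
      rw [sum_smul_mk, Submodule.Quotient.mk_eq_zero] at hg
      have hg' : ∑ i, g i • x i.1 ∈ boundaries (vietorisRips m a) k := hg
      rw [hsum] at hg'
      have := congrFun (h.indep a (ext a g) (hext a g) hg') i
      rwa [show ext a g i = g i from dif_pos i.2] at this
    · rw [Submodule.eq_top_iff']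
      intro q
      obtain ⟨⟨z, hz⟩, rfl⟩ := Submodule.Quotient.mk_surjective _ q
      obtain ⟨l, hl, hzl⟩ := h.span a z hz
      rw [Submodule.mem_span_range_iff_exists_fun]
      refine ⟨fun i => l i, ?_⟩
      simp only [homologyMap_mk]
      rw [sum_smul_mk, eq_comm, Submodule.Quotient.eq]
      rw [← sum_subtype_smul hl] at hzl
      exact hzl
  · rintro ⟨hdeath, hbasis⟩
    refine ⟨hx, fun i a ha => ?_, fun a z hz => ?_, fun a l hl hls => ?_⟩
    · have := hdeath i a (hb ha) ha
      rw [homologyMap_mk, Submodule.Quotient.mk_eq_zero] at this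
      exact this
    · have := (hbasis a).2.ge
        (Submodule.mem_top (x := (Submodule.Quotient.mk ⟨z, hz⟩ : Homology _ k)))
      rw [Submodule.mem_span_range_iff_exists_fun] at this
      obtain ⟨g, hg⟩ := this
      simp only [homologyMap_mk] at hg
      rw [sum_smul_mk, eq_comm, Submodule.Quotient.eq] at hg
      refine ⟨ext a g, hext a g, ?_⟩
      rw [← hsum]
      exact hg
    · have := (hbasis a).1
      rw [Fintype.linearIndependent_iff] at this
      have hl0 := this (fun i => l i) (by
        simp only [homologyMap_mk]
        rw [sum_smul_mk, Submodule.Quotient.mk_eq_zero]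
        have hls' : ∑ i, l i • x i ∈ boundaries (vietorisRips m a) k := hls
        rw [← sum_subtype_smul hl] at hls'
        exact hls')
      ext i
      by_contra hi
      exact hi (hl0 ⟨i, hl i hi⟩)

theorem isBarcode_iff {m : Matrix V V EReal} {k : ℕ} {B : Multiset Bar} :
    IsBarcode m k B ↔ ∃ (N : ℕ) (bar : Fin N → Bar) (x : Fin N → Finset V → ZMod 2),
      B = Finset.univ.val.map bar ∧ PersistenceBasis (fun a => cycles (vietorisRips m a) k)
        (fun a => boundaries (vietorisRips m a) k) bar x := by
  constructor
  · rintro ⟨N, bar, c, hB, hc⟩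
    choose x hx using fun i => Submodule.Quotient.mk_surjective _ (c i)
    obtain rfl : (fun i => Submodule.Quotient.mk (x i)) = c := funext hx
    exact ⟨N, bar, fun i => x i, hB, (persistenceBasis_iff fun i => (x i).2).mpr hc⟩
  · rintro ⟨N, bar, x, hB, h⟩
    exact ⟨N, bar, fun i => Submodule.Quotient.mk ⟨x i, h.mem_birth i⟩, hB,
      (persistenceBasis_iff h.mem_birth).mp h⟩

theorem mem_cycles_vietorisRips {m : Matrix V V EReal} {k : ℕ} {x : Finset V → ZMod 2} {a : ℝ} :
    x ∈ cycles (vietorisRips m a) k ↔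
      (if boundary x = 0 then chainWeight m k x else ⊤) ≤ (a : EReal) := by
  rw [cycles, Submodule.mem_inf, mem_chains_vietorisRips, LinearMap.mem_ker]
  by_cases h : boundary x = 0 <;> simp [h]

/-- Over `ZMod 2` there are finitely many chains, so the least weight of a filling is attained; with
no filling, the infimum is `⊤`. -/
theorem mem_boundaries_vietorisRips {m : Matrix V V EReal} {k : ℕ} {x : Finset V → ZMod 2} {a : ℝ} :
    x ∈ boundaries (vietorisRips m a) k ↔
      ((Finset.univ.filter fun y => boundary y = x).inf (chainWeight m (k + 1))) ≤ (a : EReal) := by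
  rw [boundaries, Submodule.mem_map, Finset.inf_le_iff (EReal.coe_lt_top a)]
  simp [mem_chains_vietorisRips, and_comm]

theorem exists_isBarcode {m : Matrix V V EReal} (hm : ∀ i, 0 ≤ m i i) (k : ℕ) :
    ∃ B, IsBarcode m k B := by
  obtain ⟨N, bar, x, h⟩ := exists_persistenceBasis
    (Z := fun a => cycles (vietorisRips m a) k) (B := fun a => boundaries (vietorisRips m a) k)
    (fun v a => mem_cycles_vietorisRips) (fun v a => mem_boundaries_vietorisRips) fun v hv hbot => by
      -- Nonnegative diagonal weights leave no simplex at a negative threshold such as `-1`.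
      have hmem : v ∈ cycles (vietorisRips m (-1)) k := mem_cycles_vietorisRips.mpr (by simp [hbot])
      obtain ⟨σ, hσ⟩ := Function.ne_iff.mp hv
      obtain ⟨⟨i, hi⟩, hle⟩ := (hmem.1 σ hσ).1
      have := (hm i).trans (hle i hi i hi)
      rw [← EReal.coe_zero, EReal.coe_le_coe_iff] at this
      linarith
  exact ⟨_, isBarcode_iff.mpr ⟨N, bar, x, rfl, h⟩⟩

theorem IsBarcode.unique {m : Matrix V V EReal} {k : ℕ} {B B' : Multiset Bar}
    (h : IsBarcode m k B) (h' : IsBarcode m k B') : B = B' := by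
  obtain ⟨N, bar, x, rfl, hb⟩ := isBarcode_iff.mp h
  obtain ⟨N', bar', x', rfl, hb'⟩ := isBarcode_iff.mp h'
  exact hb.map_bar_eq hb' fun a b hab => boundaries_mono (vietorisRips_mono m hab) k

theorem IsBarcode.bottleneckDist_le {m m' : Matrix V V EReal} {k : ℕ} {B B' : Multiset Bar} {ε : ℝ}
    (hB : IsBarcode m k B) (hB' : IsBarcode m' k B') (hε : 0 ≤ ε)
    (h : ∀ i j, m' i j ≤ m i j + ε) (h' : ∀ i j, m i j ≤ m' i j + ε) :
    bottleneckDist B B' ≤ ENNReal.ofReal ε := by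
  obtain ⟨N, bar, x, rfl, hb⟩ := isBarcode_iff.mp hB
  obtain ⟨N', bar', x', rfl, hb'⟩ := isBarcode_iff.mp hB'
  exact hb.bottleneckDist_le hb' (fun a b hab => boundaries_mono (vietorisRips_mono m hab) k)
    (fun a b hab => boundaries_mono (vietorisRips_mono m' hab) k)
    (fun a => cycles_mono (vietorisRips_le_of_le_add h a) k)
    (fun a => boundaries_mono (vietorisRips_le_of_le_add h a) k)
    (fun a => cycles_mono (vietorisRips_le_of_le_add h' a) k)
    (fun a => boundaries_mono (vietorisRips_le_of_le_add h' a) k) hε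

end Barcode

/-! ### Perturbation of the weights -/

section RCrossBarcode

variable {E F : Type*} [NormedAddCommGroup E] [NormedAddCommGroup F] {n : ℕ}

/-- Both endpoints move, which is the source of the factor `2`. -/
theorem distMatrix_le_add {X X' : Fin n → E} {δ : ℝ} (h : ∀ i, ‖X' i - X i‖ ≤ δ) (i j : Fin n) :
    distMatrix X' i j ≤ distMatrix X i j + 2 * δ := by
  have h1 : X' i - X' j = X i - X j + ((X' i - X i) - (X' j - X j)) := by abel
  have h2 := norm_add_le (X i - X j) ((X' i - X i) - (X' j - X j))
  have h3 := norm_sub_le (X' i - X i) (X' j - X j)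
  simp only [distMatrix, Matrix.of_apply]
  rw [h1]
  linarith [h i, h j]

theorem wPlus_le_add {w w' : Matrix (Fin n) (Fin n) ℝ} {ε : ℝ} (h : ∀ i j, w' i j ≤ w i j + ε)
    (i j : Fin n) : wPlus w' i j ≤ wPlus w i j + ε := by
  simp only [wPlus, Matrix.of_apply]
  split_ifs
  · simp
  · exact_mod_cast h i j

/-- The minimum is monotone and commutes with adding `ε`, and the infinite entries occupy the same
positions in both matrices. -/
theorem doubledWeights_le_add {w w' v v' : Matrix (Fin n) (Fin n) ℝ} {ε : ℝ} (hε : 0 ≤ ε)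
    (h : ∀ i j, w' i j ≤ w i j + ε) (hv : ∀ i j, v' i j ≤ v i j + ε) (i j : Fin n ⊕ Fin n) :
    doubledWeights w' v' i j ≤ doubledWeights w v i j + ε := by
  rcases i with i | i <;> rcases j with j | j
  · simpa [doubledWeights] using hε
  · exact wPlus_le_add h j i
  · exact wPlus_le_add h i j
  · simp only [doubledWeights, Matrix.fromBlocks_apply₂₂, Matrix.of_apply]
    rw [← EReal.coe_add, EReal.coe_le_coe_iff, ← min_add_add_right]
    exact min_le_min (h i j) (hv i j)

theorem existsUnique_isRCrossBarcode (k : ℕ) (X : Fin n → E) (Y : Fin n → F) :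
    ∃! B, IsRCrossBarcode k X Y B := by
  obtain ⟨B, hB⟩ := exists_isBarcode (m := doubledWeights (distMatrix X) (distMatrix Y))
    (by rintro (i | i) <;> simp [doubledWeights, distMatrix]) k
  exact ⟨B, hB, fun B' hB' => hB'.unique hB⟩

end RCrossBarcode

end RTD

end

theorem mainTheorem2 {E F : Type*} [NormedAddCommGroup E] [NormedSpace ℝ E]
    [NormedAddCommGroup F] [NormedSpace ℝ F] (n k : ℕ) (X X' : Fin n → E) (Y Y' : Fin n → F) :
    (∃! B : Multiset RTD.Bar, RTD.IsRCrossBarcode k X Y B) ∧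
    (∃! B' : Multiset RTD.Bar, RTD.IsRCrossBarcode k X' Y' B') ∧
    ∀ B B' : Multiset RTD.Bar,
      RTD.IsRCrossBarcode k X Y B → RTD.IsRCrossBarcode k X' Y' B' →
      RTD.bottleneckDist B B' ≤ 2 * max (⨆ i, ‖X' i - X i‖ₑ) (⨆ j, ‖Y' j - Y j‖ₑ) := by
  refine ⟨RTD.existsUnique_isRCrossBarcode k X Y, RTD.existsUnique_isRCrossBarcode k X' Y',
    fun B B' hB hB' => ?_⟩
  set S := max (⨆ i, ‖X' i - X i‖ₑ) (⨆ j, ‖Y' j - Y j‖ₑ)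
  -- An infinite bound would be trivial; excluding it allows real arithmetic.
  by_cases hS : S = ⊤
  · simp [hS]
  have hX : ∀ i, ‖X' i - X i‖ ≤ S.toReal := fun i => by
    rw [← toReal_enorm]
    exact ENNReal.toReal_mono hS ((le_iSup (fun i => ‖X' i - X i‖ₑ) i).trans (le_max_left _ _))
  have hY : ∀ j, ‖Y' j - Y j‖ ≤ S.toReal := fun j => by
    rw [← toReal_enorm]
    exact ENNReal.toReal_mono hS ((le_iSup (fun j => ‖Y' j - Y j‖ₑ) j).trans (le_max_right _ _))
  have hε : 0 ≤ 2 * S.toReal := by positivity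
  refine (RTD.IsBarcode.bottleneckDist_le hB hB' hε
    (RTD.doubledWeights_le_add hε (RTD.distMatrix_le_add hX) (RTD.distMatrix_le_add hY))
    (RTD.doubledWeights_le_add hε
      (RTD.distMatrix_le_add fun i => by rw [norm_sub_rev]; exact hX i)
      (RTD.distMatrix_le_add fun j => by rw [norm_sub_rev]; exact hY j))).trans ?_
  rw [ENNReal.ofReal_mul zero_le_two, ENNReal.ofReal_toReal hS, ENNReal.ofReal_ofNat]
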